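/- Let $L/k$ be a finite Galois extension of fields with group $G=\mathrm{Gal}(L/k)$, and let $\alpha: G\times G\to L^{*}$ be a $2$-cocycle (for the Galois action of $G$ on $L^*$) all of whose values are roots of unity. Let $L^{\alpha}_tG$ be the crossed product algebra, i.e. the $k$-algebra with $L$-basis $\{U_g\}_{g\in G}$ and product $(xU_g)(yU_h)=x\,g(y)\,\alpha(g,h)\,U_{gh}$ for $x,y\in L$, $g,h\in G$. Let $\widehat G$ be the subgroup of the unit group of $L^{\alpha}_tG$ generated by the $U_g$, and let $\pi:\widehat G\to G$ be the homomorphism that sends an element of $\widehat G$ of the form $xU_g$ ($x\in L^*$) to $g$. Let $T=\mathbb Z_2G$ be the elementary abelian $2$-group with $\mathbb{Z}_2$-basis $G$, on which $\widehat G$ acts through $\pi$ and left multiplication; denote this action by $\psi$. Let $k[T]\rtimes k\widehat G$ be the Hopf algebra over $k$ with basis $e_t\otimes n$ ($t\in T$, $n\in\widehat G$), product $(e_{t}\otimes n)(e_{s}\otimes m)=\delta_{t,\psi(n)(s)}\,e_{t}\otimes nm$, coproduct $\Delta(e_t\otimes n)=\sum_{rs=t}(e_r\otimes n)\otimes(e_s\otimes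 n)$ and counit $\varepsilon(e_t\otimes n)=\delta_{t,1}$. Then there is a finite-dimensional Hopf algebra $H$ over $k$ such that (i) $H$ is a $k$-form of $L\otimes_k(k[T]\rtimes k\widehat G)$, i.e. $L\otimes_kH\cong L\otimes_k(k[T]\rtimes k\widehat G)$ as Hopf algebras over $L$; (ii) there is a surjective homomorphism of $k$-algebras $H\to L^{\alpha}_tG$; (iii) if $\mathrm{char}(k)\nmid|G|$, then $H$ is semisimple. -/

import Mathlib

open scoped TensorProduct

universe u v

noncomputable section

namespace HopfSchur

/-! ### The crossed product algebra -/

section CrossedProduct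

variable {k L : Type*} [Field k] [Field L] [Algebra k L]

/-- The crossed product algebra `L^α_t G`, `G = Gal(L/k)`, of a 2-cocycle `α : G × G → Lˣ`:
the `L`-vector space with basis `(U_g)`, where `x U_g` is `single g x`, with the product
`(x U_g) (y U_h) = x g(y) α(g,h) U_{gh}`. The cocycle is not assumed to be normalized, so that the
unit element is `α(1,1)⁻¹ U_1`. -/
def CrossedProduct (α : Gal(L/k) × Gal(L/k) → Lˣ) (_hα : groupCohomology.IsMulCocycle₂ α) :=
  Gal(L/k) →₀ L

namespace CrossedProduct

variable {α : Gal(L/k) × Gal(L/k) → Lˣ} {hα : groupCohomology.IsMulCocycle₂ α}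

instance : AddCommGroup (CrossedProduct α hα) := inferInstanceAs (AddCommGroup (Gal(L/k) →₀ L))

instance : Module k (CrossedProduct α hα) := inferInstanceAs (Module k (Gal(L/k) →₀ L))

variable (hα) in
/-- The element `x U_g`. -/
def single (g : Gal(L/k)) : L →ₗ[k] CrossedProduct α hα := Finsupp.lsingle g

@[elab_as_elim]
lemma induction_single {P : CrossedProduct α hα → Prop} (a : CrossedProduct α hα)
    (zero : P 0) (add : ∀ a b, P a → P b → P (a + b)) (single : ∀ g x, P (single hα g x)) : P a :=
  Finsupp.induction_linear a zero add single

lemma single_inj {g h : Gal(L/k)} {x y : Lˣ} (e : single hα g (x : L) = single hα h (y : L)) :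
    g = h :=
  (((Finsupp.single_eq_single_iff _ _ _ _).1 e).resolve_right fun H => x.ne_zero H.1).1

variable (α hα) in
/-- The multiplication as a `k`-bilinear map. -/
def mulMap : CrossedProduct α hα →ₗ[k] CrossedProduct α hα →ₗ[k] CrossedProduct α hα :=
  Finsupp.lsum k fun g => LinearMap.flip <| Finsupp.lsum k fun h =>
    LinearMap.mk₂ k (fun y x : L => single hα (g * h) (x * g y * α (g, h)))
      (by intro y y' x; rw [← map_add]; congr 1; simp; ring)
      (by intro c y x; rw [← map_smul]; congr 1; simp)
      (by intro y x x'; rw [← map_add]; congr 1; ring)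
      (by intro c y x; rw [← map_smul]; congr 1; simp)

instance : Mul (CrossedProduct α hα) := ⟨fun a b => mulMap α hα a b⟩

instance : One (CrossedProduct α hα) := ⟨single hα 1 ((α (1, 1))⁻¹ : Lˣ)⟩

lemma mulMap_apply (a b : CrossedProduct α hα) : mulMap α hα a b = a * b := rfl

lemma one_def : (1 : CrossedProduct α hα) = single hα 1 ((α (1, 1))⁻¹ : Lˣ) := rfl

lemma single_mul_single (g h : Gal(L/k)) (x y : L) :
    single hα g x * single hα h y = single hα (g * h) (x * g y * α (g, h)) := by
  change mulMap α hα (Finsupp.single g x) (Finsupp.single h y) = _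
  unfold mulMap
  erw [Finsupp.lsum_single, LinearMap.flip_apply, Finsupp.lsum_single]
  rfl

lemma cocycle (hα : groupCohomology.IsMulCocycle₂ α) (g h j : Gal(L/k)) :
    (α (g * h, j) * α (g, h) : L) = g (α (h, j)) * α (g, h * j) :=
  congrArg Units.val (hα g h j)

instance : NonUnitalNonAssocRing (CrossedProduct α hα) where
  __ := (inferInstance : AddCommGroup (CrossedProduct α hα))
  left_distrib a b c := by simp [← mulMap_apply]
  right_distrib a b c := by simp [← mulMap_apply]
  zero_mul a := by simp [← mulMap_apply]
  mul_zero a := by simp [← mulMap_apply]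

instance : Ring (CrossedProduct α hα) where
  __ := (inferInstance : NonUnitalNonAssocRing (CrossedProduct α hα))
  mul_assoc a b c := by
    induction a using induction_single with
    | zero => simp
    | add a a' h h' => simp only [add_mul, h, h']
    | single g x =>
    induction b using induction_single with
    | zero => simp
    | add b b' h h' => simp only [add_mul, mul_add, h, h']
    | single h y =>
    induction c using induction_single with
    | zero => simp
    | add c c' h h' => simp only [mul_add, h, h']
    | single j z =>
      simp only [single_mul_single, mul_assoc g h j]
      congr 1
      simp only [map_mul, AlgEquiv.mul_apply]
      linear_combination x * g y * g (h z) * cocycle hα g h j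
  one_mul a := by
    induction a using induction_single with
    | zero => simp
    | add a a' h h' => simp only [mul_add, h, h']
    | single g x =>
      have := groupCohomology.map_one_fst_of_isMulCocycle₂ hα g
      rw [one_def, single_mul_single, one_mul, this]
      congr 1
      rw [mul_right_comm, Units.inv_mul, one_mul, AlgEquiv.one_apply]
  mul_one a := by
    induction a using induction_single with
    | zero => simp
    | add a a' h h' => simp only [add_mul, h, h']
    | single g x =>
      have := congrArg Units.val (groupCohomology.map_one_snd_of_isMulCocycle₂ hα g)
      rw [one_def, single_mul_single, mul_one, this]
      congr 1
      simp [AlgEquiv.smul_units_def]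

instance : Algebra k (CrossedProduct α hα) :=
  Algebra.ofModule (fun r a b => by simp [← mulMap_apply]) (fun r a b => by simp [← mulMap_apply])

/-- The unit `x U_g`, `x ∈ Lˣ`, of the crossed product algebra. -/
def unitSingle (hα : groupCohomology.IsMulCocycle₂ α) (g : Gal(L/k)) (x : Lˣ) :
    (CrossedProduct α hα)ˣ where
  val := single hα g x
  inv := single hα g⁻¹ ((g⁻¹ • x)⁻¹ * (α (g⁻¹, g))⁻¹ * (α (1, 1))⁻¹ : Lˣ)
  val_inv := by
    have h1 := groupCohomology.smul_map_inv_div_map_inv_of_isMulCocycle₂ hα g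
    rw [groupCohomology.map_one_snd_of_isMulCocycle₂ hα g, div_eq_div_iff_mul_eq_mul] at h1
    rw [single_mul_single, one_def, mul_inv_cancel]
    refine congrArg (single hα 1) ?_
    have h2 : x * g • ((g⁻¹ • x)⁻¹ * (α (g⁻¹, g))⁻¹ * (α (1, 1))⁻¹) * α (g, g⁻¹) =
        (α (1, 1))⁻¹ := by
      rw [smul_mul', smul_mul', smul_inv', smul_inv', smul_inv', smul_inv_smul,
        ← mul_assoc, mul_inv_cancel_left, ← mul_inv, h1, mul_inv, inv_mul_cancel_right]
    exact congrArg Units.val h2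
  inv_val := by
    rw [single_mul_single, one_def, inv_mul_cancel]
    congr 1
    simp [AlgEquiv.smul_units_def]
    field_simp

variable (α hα) in
/-- The group `Ĝ`: the subgroup of the unit group of `L^α_t G` that is generated by the `U_g`. -/
def Ghat : Subgroup (CrossedProduct α hα)ˣ :=
  Subgroup.closure (Set.range fun g => unitSingle hα g 1)

lemma exists_of_mem_Ghat {u : (CrossedProduct α hα)ˣ} (hu : u ∈ Ghat α hα) :
    ∃ g : Gal(L/k), ∃ x : Lˣ, (u : CrossedProduct α hα) = single hα g (x : L) := by
  induction hu using Subgroup.closure_induction with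
  | mem u hu => obtain ⟨g, rfl⟩ := hu; exact ⟨g, 1, rfl⟩
  | one => exact ⟨1, _, one_def⟩
  | mul u v _ _ hu hv =>
    obtain ⟨g, x, hu⟩ := hu
    obtain ⟨h, y, hv⟩ := hv
    exact ⟨g * h, x * g • y * α (g, h), by rw [Units.val_mul, hu, hv, single_mul_single]; rfl⟩
  | inv u _ hu =>
    obtain ⟨g, x, hu⟩ := hu
    obtain rfl : u = unitSingle hα g x := Units.ext hu
    exact ⟨_, _, rfl⟩

variable (α hα) in
/-- The projection `Ĝ → G`, which sends an element `x U_g` of `Ĝ` to `g`. -/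
def proj : Ghat α hα →* Gal(L/k) :=
  MonoidHom.mk' (fun u => (exists_of_mem_Ghat u.2).choose) fun u v => by
    obtain ⟨x, hx⟩ := (exists_of_mem_Ghat u.2).choose_spec
    obtain ⟨y, hy⟩ := (exists_of_mem_Ghat v.2).choose_spec
    obtain ⟨z, hz⟩ := (exists_of_mem_Ghat (u * v).2).choose_spec
    have h : ((u * v : Ghat α hα) : (CrossedProduct α hα)ˣ).val = _ * _ := rfl
    rw [hx, hy, single_mul_single] at h
    exact (single_inj (hα := hα) (x := x * (exists_of_mem_Ghat u.2).choose • y * α (_, _))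
      (y := z) (h.symm.trans hz)).symm

lemma exists_eq_single_proj (u : Ghat α hα) :
    ∃ x : Lˣ, ((u : (CrossedProduct α hα)ˣ) : CrossedProduct α hα) =
      single hα (proj α hα u) (x : L) :=
  (exists_of_mem_Ghat u.2).choose_spec

end CrossedProduct

end CrossedProduct

/-! ### The semidirect product of a function algebra and a group algebra -/

section Semidirect

variable (k : Type*) [CommRing k] {T N : Type*} [Group T] [Group N]

/-- The semidirect product `k[T] ⋊ kN` of the function algebra `k[T]` of a finite group `T` and the
group algebra `kN`, for an action `ψ` of the group `N` on `T` by automorphisms. The basis vector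
`e_t ⊗ n` is `basis k ψ (t, n)`; here `e_t` is the indicator function of `t`. -/
def SemidirectHopf (_ψ : N →* MulAut T) := (T × N) →₀ k

namespace SemidirectHopf

variable {ψ : N →* MulAut T}

instance : AddCommGroup (SemidirectHopf k ψ) := inferInstanceAs (AddCommGroup ((T × N) →₀ k))

instance : Module k (SemidirectHopf k ψ) := inferInstanceAs (Module k ((T × N) →₀ k))

variable (ψ) in
/-- The basis `(e_t ⊗ n)` of `k[T] ⋊ kN`. -/
def basis : Module.Basis (T × N) k (SemidirectHopf k ψ) := ⟨LinearEquiv.refl k _⟩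

variable (ψ) in
open Classical in
/-- The product, `(e_t ⊗ n) (e_s ⊗ m) = δ_{t, ψ(n)(s)} e_t ⊗ n m`, as a bilinear map. -/
def mulMap : SemidirectHopf k ψ →ₗ[k] SemidirectHopf k ψ →ₗ[k] SemidirectHopf k ψ :=
  (basis k ψ).constr k fun p => (basis k ψ).constr k fun q =>
    if p.1 = ψ p.2 q.1 then basis k ψ (p.1, p.2 * q.2) else 0

instance : Mul (SemidirectHopf k ψ) := ⟨fun a b => mulMap k ψ a b⟩

variable {k}

lemma mulMap_apply (a b : SemidirectHopf k ψ) : mulMap k ψ a b = a * b := rfl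

open Classical in
lemma basis_mul_basis (p q : T × N) : basis k ψ p * basis k ψ q =
    if p.1 = ψ p.2 q.1 then basis k ψ (p.1, p.2 * q.2) else 0 := by
  rw [← mulMap_apply, mulMap, Module.Basis.constr_basis, Module.Basis.constr_basis]

@[elab_as_elim]
lemma induction_basis {P : SemidirectHopf k ψ → Prop} (a : SemidirectHopf k ψ)
    (zero : P 0) (add : ∀ a b, P a → P b → P (a + b))
    (smul : ∀ (c : k) a, P a → P (c • a)) (basis : ∀ p, P (basis k ψ p)) : P a :=
  Submodule.span_induction (p := fun a _ => P a) (by rintro _ ⟨p, rfl⟩; exact basis p) zero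
    (fun a b _ _ => add a b) (fun c a _ => smul c a)
    ((SemidirectHopf.basis k ψ).mem_span a)

variable [Fintype T]

/-- The unit element `∑ t, e_t ⊗ 1`. -/
instance : One (SemidirectHopf k ψ) := ⟨∑ t : T, basis k ψ (t, 1)⟩

lemma one_def : (1 : SemidirectHopf k ψ) = ∑ t : T, basis k ψ (t, 1) := rfl

instance : NonUnitalNonAssocRing (SemidirectHopf k ψ) where
  __ := (inferInstance : AddCommGroup (SemidirectHopf k ψ))
  left_distrib a b c := by simp [← mulMap_apply]
  right_distrib a b c := by simp [← mulMap_apply]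
  zero_mul a := by simp [← mulMap_apply]
  mul_zero a := by simp [← mulMap_apply]

instance : IsScalarTower k (SemidirectHopf k ψ) (SemidirectHopf k ψ) :=
  ⟨fun r a b => by simp [← mulMap_apply]⟩

instance : SMulCommClass k (SemidirectHopf k ψ) (SemidirectHopf k ψ) :=
  ⟨fun r a b => by simp [← mulMap_apply]⟩

instance : Ring (SemidirectHopf k ψ) where
  __ := (inferInstance : NonUnitalNonAssocRing (SemidirectHopf k ψ))
  mul_assoc a b c := by
    classical
    induction a using induction_basis with
    | zero => simp
    | add a a' h h' => simp only [add_mul, h, h']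
    | smul r a h => simp only [smul_mul_assoc, h]
    | basis p =>
    induction b using induction_basis with
    | zero => simp
    | add b b' h h' => simp only [add_mul, mul_add, h, h']
    | smul r a h => simp only [smul_mul_assoc, mul_smul_comm, h]
    | basis q =>
    induction c using induction_basis with
    | zero => simp
    | add c c' h h' => simp only [mul_add, h, h']
    | smul r a h => simp only [mul_smul_comm, h]
    | basis s =>
      rw [basis_mul_basis, basis_mul_basis]
      by_cases h1 : p.1 = ψ p.2 q.1 <;> by_cases h2 : q.1 = ψ q.2 s.1 <;>
        simp_all [basis_mul_basis, mul_assoc]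
  one_mul a := by
    classical
    induction a using induction_basis with
    | zero => simp
    | add a a' h h' => simp only [mul_add, h, h']
    | smul r a h => simp only [mul_smul_comm, h]
    | basis p => simp [one_def, Finset.sum_mul, basis_mul_basis]
  mul_one a := by
    classical
    induction a using induction_basis with
    | zero => simp
    | add a a' h h' => simp only [add_mul, h, h']
    | smul r a h => simp only [smul_mul_assoc, h]
    | basis p => 
      simp [one_def, Finset.mul_sum, basis_mul_basis, ← MulEquiv.symm_apply_eq]

instance : Algebra k (SemidirectHopf k ψ) := Algebra.ofModule smul_mul_assoc mul_smul_comm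

open Classical in
/-- The tensor product coalgebra structure:
`Δ(e_t ⊗ n) = ∑_{r s = t} (e_r ⊗ n) ⊗ (e_s ⊗ n)` and `ε(e_t ⊗ n) = δ_{t, 1}`. -/
instance : CoalgebraStruct k (SemidirectHopf k ψ) where
  comul := (basis k ψ).constr k fun p =>
    ∑ r : T, basis k ψ (r, p.2) ⊗ₜ[k] basis k ψ (r⁻¹ * p.1, p.2)
  counit := (basis k ψ).constr k fun p => if p.1 = 1 then 1 else 0

lemma comul_basis (p : T × N) : Coalgebra.comul (R := k) (basis k ψ p) =
    ∑ r : T, basis k ψ (r, p.2) ⊗ₜ[k] basis k ψ (r⁻¹ * p.1, p.2) :=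
  (basis k ψ).constr_basis ..

open Classical in
lemma counit_basis (p : T × N) :
    Coalgebra.counit (R := k) (basis k ψ p) = if p.1 = 1 then 1 else 0 :=
  (basis k ψ).constr_basis ..

instance : Coalgebra k (SemidirectHopf k ψ) where
  coassoc := by
    refine (basis k ψ).ext fun p => ?_
    simp only [LinearMap.comp_apply, comul_basis, map_sum, LinearMap.rTensor_tmul,
      LinearMap.lTensor_tmul, TensorProduct.sum_tmul, TensorProduct.tmul_sum,
      LinearEquiv.coe_coe, TensorProduct.assoc_tmul]
    rw [Finset.sum_comm]
    refine Finset.sum_congr rfl fun r _ => ?_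
    refine Fintype.sum_equiv (Equiv.mulLeft r⁻¹) _ _ fun s => ?_
    simp [mul_assoc]
  rTensor_counit_comp_comul := by
    refine (basis k ψ).ext fun p => ?_
    simp only [LinearMap.comp_apply, comul_basis, map_sum, LinearMap.rTensor_tmul, counit_basis,
      TensorProduct.mk_apply]
    rw [Fintype.sum_eq_single 1]
    · simp
    · intro r hr
      simp [hr]
  lTensor_counit_comp_comul := by
    refine (basis k ψ).ext fun p => ?_
    simp only [LinearMap.comp_apply, comul_basis, map_sum, LinearMap.lTensor_tmul, counit_basis,
      LinearMap.flip_apply, TensorProduct.mk_apply]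
    rw [Fintype.sum_eq_single p.1]
    · simp
    · intro r hr
      simp [inv_mul_eq_one, hr]

lemma counit_mul' (a b : SemidirectHopf k ψ) : Coalgebra.counit (R := k) (a * b) =
    Coalgebra.counit (R := k) a * Coalgebra.counit (R := k) b := by
  classical
  induction a using induction_basis with
  | zero => simp
  | add a a' h h' => simp only [add_mul, map_add, h, h']
  | smul r a h => simp only [smul_mul_assoc, map_smul, h]
  | basis p =>
  induction b using induction_basis with
  | zero => simp
  | add b b' h h' => simp only [mul_add, map_add, h, h']
  | smul r a h => simp only [mul_smul_comm, map_smul, h]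
  | basis q =>
    rw [basis_mul_basis, counit_basis, counit_basis, apply_ite (Coalgebra.counit (R := k)),
      counit_basis, map_zero]
    by_cases h1 : p.1 = 1 <;> by_cases h2 : q.1 = 1 <;> simp [h1, h2, eq_comm (a := (1 : T))]

lemma comul_mul' (a b : SemidirectHopf k ψ) : Coalgebra.comul (R := k) (a * b) =
    Coalgebra.comul (R := k) a * Coalgebra.comul (R := k) b := by
  classical
  induction a using induction_basis with
  | zero => simp
  | add a a' h h' => simp only [add_mul, map_add, h, h']
  | smul r a h => simp only [smul_mul_assoc, map_smul, h]
  | basis p =>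
  induction b using induction_basis with
  | zero => simp
  | add b b' h h' => simp only [mul_add, map_add, h, h']
  | smul r a h => simp only [mul_smul_comm, map_smul, h]
  | basis q =>
    rw [basis_mul_basis, comul_basis, comul_basis, Finset.sum_mul_sum,
      apply_ite (Coalgebra.comul (R := k)), comul_basis, map_zero]
    simp only [Algebra.TensorProduct.tmul_mul_tmul, basis_mul_basis]
    have key (i : T) : ∑ j : T, (if i = ψ p.2 j then basis k ψ (i, p.2 * q.2) else 0) ⊗ₜ[k]
        (if i⁻¹ * p.1 = ψ p.2 (j⁻¹ * q.1) then basis k ψ (i⁻¹ * p.1, p.2 * q.2) else 0) =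
        if p.1 = ψ p.2 q.1 then
          basis k ψ (i, p.2 * q.2) ⊗ₜ[k] basis k ψ (i⁻¹ * p.1, p.2 * q.2) else 0 := by
      rw [Fintype.sum_eq_single ((ψ p.2).symm i)]
      · simp [TensorProduct.tmul_ite]
      · intro j hj
        rw [if_neg, TensorProduct.zero_tmul]
        rintro rfl
        simp at hj
    simp only [key]
    split_ifs <;> simp

instance : Bialgebra k (SemidirectHopf k ψ) :=
  Bialgebra.mk' k _
    (by classical simp [one_def, counit_basis])
    (counit_mul' _ _)
    (by
      simp only [one_def, map_sum, comul_basis, Algebra.TensorProduct.one_def,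
        TensorProduct.sum_tmul, TensorProduct.tmul_sum]
      rw [Finset.sum_comm]
      nth_rw 2 [Finset.sum_comm]
      exact Finset.sum_congr rfl fun r _ =>
        Fintype.sum_equiv (Equiv.mulLeft r⁻¹) _ _ fun s => by simp)
    (comul_mul' _ _)

/-- The antipode, `S(e_t ⊗ n) = (1 ⊗ n⁻¹) (e_{t⁻¹} ⊗ 1) = e_{ψ(n⁻¹)(t⁻¹)} ⊗ n⁻¹`. -/
instance : HopfAlgebraStruct k (SemidirectHopf k ψ) where
  antipode := (basis k ψ).constr k fun p => basis k ψ (ψ p.2⁻¹ p.1⁻¹, p.2⁻¹)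

lemma antipode_basis (p : T × N) : HopfAlgebra.antipode k (basis k ψ p) =
    basis k ψ (ψ p.2⁻¹ p.1⁻¹, p.2⁻¹) :=
  (basis k ψ).constr_basis ..

instance : HopfAlgebra k (SemidirectHopf k ψ) where
  mul_antipode_rTensor_comul := by
    classical
    refine (basis k ψ).ext fun p => ?_
    simp only [LinearMap.comp_apply, comul_basis, map_sum, LinearMap.rTensor_tmul,
      LinearMap.mul'_apply, antipode_basis, basis_mul_basis, counit_basis]
    by_cases h : p.1 = 1
    · rw [if_pos h, Algebra.linearMap_apply, map_one, one_def]
      simp only [h, mul_one, if_true, inv_mul_cancel]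
      exact Fintype.sum_equiv ((Equiv.inv T).trans (ψ p.2⁻¹).toEquiv) _ _ fun r => rfl
    · simp [h]
  mul_antipode_lTensor_comul := by
    classical
    refine (basis k ψ).ext fun p => ?_
    simp only [LinearMap.comp_apply, comul_basis, map_sum, LinearMap.lTensor_tmul,
      LinearMap.mul'_apply, antipode_basis, basis_mul_basis, counit_basis]
    by_cases h : p.1 = 1
    · simp [h, one_def]
    · simp [h]

end SemidirectHopf

end Semidirect

/-! ### The group `ℤ₂G` -/

section Z2Group

/-- The group `ℤ₂G` for a finite group `G`, written multiplicatively: the vector space over `ℤ/2`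
with basis `G`. -/
def Z2Group (G : Type*) := Multiplicative (G → ZMod 2)

variable {G : Type*}

instance : CommGroup (Z2Group G) := inferInstanceAs (CommGroup (Multiplicative (G → ZMod 2)))

instance [Finite G] : Finite (Z2Group G) := inferInstanceAs (Finite (G → ZMod 2))

instance [Finite G] : Fintype (Z2Group G) := Fintype.ofFinite _

variable [Group G]

/-- The action of `G` on `ℤ₂G` by left multiplication, which sends a basis vector `h` to `g h`. -/
def leftMul : G →* MulAut (Z2Group G) where
  toFun g :=
    { toFun t := Multiplicative.ofAdd fun h => Multiplicative.toAdd t (g⁻¹ * h)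
      invFun t := Multiplicative.ofAdd fun h => Multiplicative.toAdd t (g * h)
      left_inv t := by simp; rfl
      right_inv t := by simp; rfl
      map_mul' s t := rfl }
  map_one' := by ext t; simp; rfl
  map_mul' g g' := by ext t; simp [mul_assoc]; rfl

end Z2Group

/-- The Hopf algebra `k[T] ⋊ kĜ` for `T = ℤ₂G`, on which `Ĝ` acts through `Ĝ → G` and left
multiplication. -/
abbrev SplitHopf {k L : Type*} [Field k] [Field L] [Algebra k L]
    (α : Gal(L/k) × Gal(L/k) → Lˣ) (hα : groupCohomology.IsMulCocycle₂ α) :=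
  SemidirectHopf k ((leftMul (G := Gal(L/k))).comp (CrossedProduct.proj α hα))

end HopfSchur

end

/-! The form is obtained by Galois descent. Left and right multiplication on `T = ℤ₂G` commute, so
`G` acts on `k[T] ⋊ kĜ` by Hopf automorphisms through right multiplication on `T`. Combined with the
Galois action on `L`, this gives a semilinear action on `B = L ⊗ (k[T] ⋊ kĜ)`. Let `H` be its
algebra of invariants. Descent (`isBaseChange_fixed`, `comul_mem`) shows that `L ⊗ H = B` and that
the Hopf operations of `B` restrict to `H`; the Hopf axioms for `H` follow from those of `B`,
because the tensor powers of `H` over `k` embed in those of `B` over `L`.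

The map to the crossed product evaluates functions on `T` at the basis vector `δ₁` and sends `n ∈ Ĝ`
to itself. It is not multiplicative on `B`: moving `n` past a function translates the point of
evaluation by `g = π(n)` on the left. For an invariant second factor, this translation can be traded
for right multiplication by `g` together with the Galois action of `g`. Conjugation by `g` fixes
`δ₁`, so what remains is the relation `U_g c = g(c) U_g` (`evalMap_mul_act`). The map is onto
because `δ₁` has trivial stabilizer under right multiplication: the trace of `x ⊗ e_{δ₁} ⊗ U_g`
evaluates to `x U_g`.

For semisimplicity, `H` is spanned by products of invariant functions and elements of `Ĝ`. The
invariant functions form a finite-dimensional reduced commutative algebra, hence a semisimple one,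
and `Ĝ` normalizes it. Maschke averaging over `Ĝ` applies because the kernel of `Ĝ → G` lies in
`Lˣ`, which has no element of order `p` in characteristic `p`. -/

noncomputable section

namespace HopfSchur

/-! ### Tensor products along a base change -/

section TensorRestrict

variable {k L M N P Q : Type*} [Field k] [Field L] [Algebra k L]
  [AddCommGroup M] [Module k M] [AddCommGroup N] [Module k N]
  [AddCommGroup P] [Module k P] [Module L P] [IsScalarTower k L P]
  [AddCommGroup Q] [Module k Q] [Module L Q] [IsScalarTower k L Q]

variable (L) in
/-- The map `M ⊗[k] N → P ⊗[L] Q` induced by `k`-linear maps `M → P` and `N → Q`. -/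
def tensorRestrict (i : M →ₗ[k] P) (j : N →ₗ[k] Q) : M ⊗[k] N →ₗ[k] P ⊗[L] Q :=
  TensorProduct.mapOfCompatibleSMul L k k P Q ∘ₗ TensorProduct.map i j

@[simp]
lemma tensorRestrict_tmul (i : M →ₗ[k] P) (j : N →ₗ[k] Q) (m : M) (n : N) :
    tensorRestrict L i j (m ⊗ₜ n) = i m ⊗ₜ j n := rfl

variable {I J : Type*}

/-- Independence over `L` of the image of a basis, unlike injectivity over `k`, passes to tensor
products taken over `L`; hence it can be iterated to reach triple tensor products. -/
lemma linearIndependent_tensorRestrict {i : M →ₗ[k] P} {j : N →ₗ[k] Q}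
    {b : Module.Basis I k M} {c : Module.Basis J k N} (hb : LinearIndependent L (i ∘ b))
    (hc : LinearIndependent L (j ∘ c)) :
    LinearIndependent L (tensorRestrict L i j ∘ b.tensorProduct c) := by
  convert! hb.tmul_of_isDomain hc using 1
  ext ⟨x, y⟩
  simp

lemma injective_of_linearIndependent_basis {i : M →ₗ[k] P} (b : Module.Basis I k M)
    (hb : LinearIndependent L (i ∘ b)) : Function.Injective i :=
  LinearMap.injective_of_linearIndependent (v := b) b.span_eq
    (hb.restrict_scalars' k)

lemma linearIndependent_of_isBaseChange {i : M →ₗ[k] P} (hi : IsBaseChange L i)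
    (b : Module.Basis I k M) : LinearIndependent L (i ∘ b) := by
  convert! (hi.basis b).linearIndependent using 1
  ext x
  rw [IsBaseChange.basis_apply]
  rfl

end TensorRestrict

/-! ### Forms of Hopf algebras -/

section Form

open Coalgebra HopfAlgebra

variable (k L H B : Type*) [Field k] [Field L] [Algebra k L] [Ring H] [Algebra k H]
  [Ring B] [HopfAlgebra L B] [Algebra k B] [IsScalarTower k L B]

/-- A `k`-algebra `H` inside a Hopf algebra `B` over `L` such that `L ⊗[k] H = B` and the
operations of `B` restrict to `H`. -/
structure HopfForm where
  /-- The inclusion. -/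
  incl : H →ₐ[k] B
  isBaseChange : IsBaseChange L incl.toLinearMap
  /-- The restricted comultiplication. -/
  comul : H →ₗ[k] H ⊗[k] H
  /-- The restricted counit. -/
  counit : H →ₗ[k] k
  /-- The restricted antipode. -/
  antipode : H →ₗ[k] H
  tensorRestrict_comul (x : H) : tensorRestrict L incl.toLinearMap incl.toLinearMap (comul x) =
    Coalgebra.comul (R := L) (incl x)
  algebraMap_counit (x : H) : algebraMap k L (counit x) = Coalgebra.counit (R := L) (incl x)
  incl_antipode (x : H) : incl (antipode x) = HopfAlgebra.antipode L (incl x)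

namespace HopfForm

variable {k L H B} (F : HopfForm k L H B)

/-- The inclusion `H ⊗[k] H → B ⊗[L] B`. -/
def incl₂ : H ⊗[k] H →ₗ[k] B ⊗[L] B := tensorRestrict L F.incl.toLinearMap F.incl.toLinearMap

/-- The inclusion `H ⊗[k] (H ⊗[k] H) → B ⊗[L] (B ⊗[L] B)`. -/
def incl₃ : H ⊗[k] (H ⊗[k] H) →ₗ[k] B ⊗[L] (B ⊗[L] B) :=
  tensorRestrict L F.incl.toLinearMap F.incl₂

@[simp] lemma incl₂_tmul (x y : H) : F.incl₂ (x ⊗ₜ y) = F.incl x ⊗ₜ F.incl y := rfl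

@[simp] lemma incl₃_tmul (x : H) (y : H ⊗[k] H) : F.incl₃ (x ⊗ₜ y) = F.incl x ⊗ₜ F.incl₂ y := rfl

lemma incl₂_comul (x : H) : F.incl₂ (F.comul x) = Coalgebra.comul (R := L) (F.incl x) :=
  F.tensorRestrict_comul x

lemma linearIndependent_incl :
    LinearIndependent L (F.incl.toLinearMap ∘ Module.Basis.ofVectorSpace k H) :=
  linearIndependent_of_isBaseChange F.isBaseChange _

lemma incl_injective : Function.Injective F.incl :=
  injective_of_linearIndependent_basis _ F.linearIndependent_incl

lemma incl₂_injective : Function.Injective F.incl₂ :=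
  injective_of_linearIndependent_basis _
    (linearIndependent_tensorRestrict F.linearIndependent_incl F.linearIndependent_incl)

/-- This reduces coassociativity of the form to coassociativity in `B`. The lemmas that follow move
each structure map across the inclusions, by checking pure tensors. -/
lemma incl₃_injective : Function.Injective F.incl₃ :=
  injective_of_linearIndependent_basis _
    (linearIndependent_tensorRestrict F.linearIndependent_incl
      (linearIndependent_tensorRestrict F.linearIndependent_incl F.linearIndependent_incl))

lemma incl₃_assoc_tmul (w : H ⊗[k] H) (y : H) : F.incl₃ (TensorProduct.assoc k H H H (w ⊗ₜ y)) =
    TensorProduct.assoc L B B B (F.incl₂ w ⊗ₜ F.incl y) := by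
  induction w with
  | zero => simp
  | add a b ha hb => simp only [TensorProduct.add_tmul, map_add, ha, hb]
  | tmul a b => simp

lemma incl₃_assoc_rTensor (w : H ⊗[k] H) :
    F.incl₃ (TensorProduct.assoc k H H H (F.comul.rTensor H w)) =
      TensorProduct.assoc L B B B ((Coalgebra.comul (R := L) (A := B)).rTensor B (F.incl₂ w)) := by
  induction w with
  | zero => simp
  | add a b ha hb => simp only [map_add, ha, hb]
  | tmul a b => simp [incl₃_assoc_tmul, incl₂_comul]

lemma incl₃_lTensor (w : H ⊗[k] H) : F.incl₃ (F.comul.lTensor H w) =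
      (Coalgebra.comul (R := L) (A := B)).lTensor B (F.incl₂ w) := by
  induction w with
  | zero => simp
  | add a b ha hb => simp only [map_add, ha, hb]
  | tmul a b => simp [incl₂_comul]

lemma incl_lid_rTensor (w : H ⊗[k] H) :
    F.incl (TensorProduct.lid k H (F.counit.rTensor H w)) =
      TensorProduct.lid L B ((Coalgebra.counit (R := L) (A := B)).rTensor B (F.incl₂ w)) := by
  induction w with
  | zero => simp
  | add a b ha hb => simp only [map_add, ha, hb]
  | tmul a b => simp [← F.algebraMap_counit]

lemma incl_rid_lTensor (w : H ⊗[k] H) :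
    F.incl (TensorProduct.rid k H (F.counit.lTensor H w)) =
      TensorProduct.rid L B ((Coalgebra.counit (R := L) (A := B)).lTensor B (F.incl₂ w)) := by
  induction w with
  | zero => simp
  | add a b ha hb => simp only [map_add, ha, hb]
  | tmul a b => simp [← F.algebraMap_counit]

lemma incl₂_mul (v w : H ⊗[k] H) : F.incl₂ (v * w) = F.incl₂ v * F.incl₂ w := by
  induction v with
  | zero => simp
  | add a b ha hb => simp only [add_mul, map_add, ha, hb]
  | tmul a b =>
  induction w with
  | zero => simp
  | add c d hc hd => simp only [mul_add, map_add, hc, hd]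
  | tmul c d => simp

lemma incl_mul'_rTensor (w : H ⊗[k] H) :
    F.incl (LinearMap.mul' k H (F.antipode.rTensor H w)) =
      LinearMap.mul' L B ((HopfAlgebra.antipode L (A := B)).rTensor B (F.incl₂ w)) := by
  induction w with
  | zero => simp
  | add a b ha hb => simp only [map_add, ha, hb]
  | tmul a b => simp [F.incl_antipode]

lemma incl_mul'_lTensor (w : H ⊗[k] H) :
    F.incl (LinearMap.mul' k H (F.antipode.lTensor H w)) =
      LinearMap.mul' L B ((HopfAlgebra.antipode L (A := B)).lTensor B (F.incl₂ w)) := by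
  induction w with
  | zero => simp
  | add a b ha hb => simp only [map_add, ha, hb]
  | tmul a b => simp [F.incl_antipode]

/-- The coalgebra structure of a form. -/
abbrev toCoalgebra : Coalgebra k H where
  comul := F.comul
  counit := F.counit
  coassoc := by
    ext x
    apply F.incl₃_injective
    simp only [LinearMap.comp_apply, LinearEquiv.coe_coe]
    rw [incl₃_assoc_rTensor, incl₃_lTensor, incl₂_comul, Coalgebra.coassoc_apply]
  rTensor_counit_comp_comul := by
    ext x
    apply (TensorProduct.lid k H).injective
    apply F.incl_injective
    simp only [LinearMap.comp_apply]
    rw [incl_lid_rTensor, incl₂_comul, Coalgebra.rTensor_counit_comul]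
    simp
  lTensor_counit_comp_comul := by
    ext x
    apply (TensorProduct.rid k H).injective
    apply F.incl_injective
    simp only [LinearMap.comp_apply]
    rw [incl_rid_lTensor, incl₂_comul, Coalgebra.lTensor_counit_comul]
    simp

/-- The bialgebra structure of a form. -/
abbrev toBialgebra : Bialgebra k H :=
  letI := F.toCoalgebra
  Bialgebra.mk' k H
    (by
      apply (algebraMap k L).injective
      change algebraMap k L (F.counit 1) = _
      simp [F.algebraMap_counit])
    (by
      intro a b
      apply (algebraMap k L).injective
      change algebraMap k L (F.counit _) = algebraMap k L (F.counit _ * F.counit _)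
      simp [F.algebraMap_counit])
    (by
      apply F.incl₂_injective
      refine (F.incl₂_comul _).trans ?_
      simp [Algebra.TensorProduct.one_def])
    (by
      intro a b
      apply F.incl₂_injective
      refine (F.incl₂_comul _).trans ?_
      rw [incl₂_mul]
      refine Eq.trans ?_ (congrArg₂ (· * ·) (F.incl₂_comul _) (F.incl₂_comul _)).symm
      simp)

/-- The Hopf algebra structure of a form. -/
abbrev toHopfAlgebra : HopfAlgebra k H where
  __ := F.toBialgebra
  antipode := F.antipode
  mul_antipode_rTensor_comul := by
    ext x
    apply F.incl_injective
    refine (F.incl_mul'_rTensor (F.comul x)).trans ?_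
    rw [incl₂_comul, HopfAlgebra.mul_antipode_rTensor_comul_apply, ← F.algebraMap_counit,
      ← IsScalarTower.algebraMap_apply]
    exact (F.incl.commutes _).symm
  mul_antipode_lTensor_comul := by
    ext x
    apply F.incl_injective
    refine (F.incl_mul'_lTensor (F.comul x)).trans ?_
    rw [incl₂_comul, HopfAlgebra.mul_antipode_lTensor_comul_apply, ← F.algebraMap_counit,
      ← IsScalarTower.algebraMap_apply]
    exact (F.incl.commutes _).symm

/-- The algebra homomorphism `L ⊗[k] H → B`. -/
def baseChangeHom : L ⊗[k] H →ₐ[L] B :=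
  Algebra.TensorProduct.lift (Algebra.ofId L B) F.incl fun l _ => Algebra.commutes l _

lemma baseChangeHom_tmul (l : L) (x : H) : F.baseChangeHom (l ⊗ₜ x) = l • F.incl x := by
  rw [Algebra.smul_def]
  exact Algebra.TensorProduct.lift_tmul ..

lemma baseChangeHom_bijective : Function.Bijective F.baseChangeHom := by
  convert! F.isBaseChange.equiv.bijective using 1
  ext x
  induction x with
  | zero => simp
  | add a b ha hb => simp only [map_add, ha, hb]
  | tmul a b => rw [baseChangeHom_tmul, IsBaseChange.equiv_tmul]; rfl

/-- The argument of the map is how the comultiplication of `L ⊗[k] H` expands on `1 ⊗ x` when `w =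
Δ(x)`; the identity thus yields compatibility of `baseChangeHom` with comultiplication. -/
lemma map_baseChangeHom_tensorComm (w : H ⊗[k] H) :
    TensorProduct.map F.baseChangeHom.toLinearMap F.baseChangeHom.toLinearMap
      (TensorProduct.AlgebraTensorModule.tensorTensorTensorComm k L k L L L H H
        ((Coalgebra.comul (R := L) (1 : L)) ⊗ₜ w)) = F.incl₂ w := by
  induction w with
  | zero => simp
  | add a b ha hb => simp only [TensorProduct.tmul_add, map_add, ha, hb]
  | tmul a b => simp [baseChangeHom_tmul]

/-- The isomorphism `L ⊗[k] H ≃ B` of Hopf algebras over `L`. -/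
def baseChangeEquiv : letI := F.toHopfAlgebra; L ⊗[k] H ≃ₐc[L] B :=
  letI := F.toHopfAlgebra
  BialgEquiv.ofAlgEquiv (AlgEquiv.ofBijective F.baseChangeHom F.baseChangeHom_bijective)
    (by
      ext x
      have := F.algebraMap_counit x
      simp [baseChangeHom_tmul, ← this, Algebra.smul_def]
      rfl)
    (by
      ext x
      change TensorProduct.map F.baseChangeHom.toLinearMap F.baseChangeHom.toLinearMap
        (Coalgebra.comul (R := L) ((1 : L) ⊗ₜ[k] x)) =
        Coalgebra.comul (R := L) (F.baseChangeHom ((1 : L) ⊗ₜ[k] x))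
      rw [TensorProduct.comul_tmul, baseChangeHom_tmul, one_smul, ← F.incl₂_comul]
      exact F.map_baseChangeHom_tensorComm (F.comul x))

end HopfForm

end Form

/-! ### Galois descent -/

section Descent

variable {k L : Type*} [Field k] [Field L] [Algebra k L]

variable (k L) in
open Classical in
/-- Dedekind's independence of automorphisms, in dual form. -/
lemma exists_sum_mul_apply_eq_ite [FiniteDimensional k L] : ∃ (n : ℕ) (c l : Fin n → L),
    ∀ g : Gal(L/k), ∑ i, c i * g (l i) = if g = 1 then 1 else 0 := by
  let b := Module.finBasis k L
  let v : Gal(L/k) → (Fin (Module.finrank k L) → L) := fun g i => g (b i)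
  have hv : LinearIndependent L v := by
    have h := (linearIndependent_toLinearMap k L L).comp (fun g : Gal(L/k) => (g : L →ₐ[k] L))
      fun g g' e => AlgEquiv.ext fun x => AlgHom.congr_fun e x
    rw [Fintype.linearIndependent_iff] at h ⊢
    intro a ha
    refine h a (b.ext fun i => ?_)
    simpa [v] using congrFun ha i
  -- The coefficients `c i` are the coordinates of the linear functional that is `1` on the vector
  -- of the identity automorphism and `0` on the vectors of the others.
  obtain ⟨φ, hφ⟩ := LinearMap.exists_leftInverse_of_injective
    (Finsupp.linearCombination L v) (LinearMap.ker_eq_bot.2 hv)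
  refine ⟨_, fun i => φ (Pi.single i 1) 1, b, fun g => ?_⟩
  have h1 : φ (v g) = Finsupp.single g 1 := by
    simpa using LinearMap.congr_fun hφ (Finsupp.single g 1)
  have h2 : v g = ∑ i, g (b i) • Pi.single i (1 : L) := by
    exact pi_eq_sum_univ' (v g)
  rw [h2, map_sum] at h1
  have h3 := DFunLike.congr_fun h1 1
  rw [Finsupp.finsetSum_apply] at h3
  simp only [map_smul, Finsupp.smul_apply, smul_eq_mul, Finsupp.single_apply] at h3
  rw [← h3]
  exact Finset.sum_congr rfl fun i _ => mul_comm _ _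

variable (k L) (B : Type*) [Ring B] [HopfAlgebra L B] [Algebra k B] [IsScalarTower k L B]

/-- An action of `Gal(L/k)` on a Hopf algebra `B` over `L` by semilinear automorphisms that are
compatible with the Hopf algebra structure. -/
structure GaloisHopfAction where
  /-- The action. -/
  act : Gal(L/k) →* (B →ₐ[k] B)
  act_smul (g : Gal(L/k)) (l : L) (x : B) : act g (l • x) = g l • act g x
  -- Expresses `Δ ∘ g = (g ⊗ g) ∘ Δ` without constructing the semilinear map `g ⊗ g` on `B ⊗[L] B`:
  -- a lift `w` of `Δ(x)` to `B ⊗[k] B`, the same for all `g`, is enough.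
  exists_comul_act (x : B) : ∃ w : B ⊗[k] B, ∀ g : Gal(L/k), Coalgebra.comul (R := L) (act g x) =
    tensorRestrict L (act g).toLinearMap (act g).toLinearMap w
  counit_act (g : Gal(L/k)) (x : B) :
    Coalgebra.counit (R := L) (act g x) = g (Coalgebra.counit (R := L) x)
  antipode_act (g : Gal(L/k)) (x : B) :
    HopfAlgebra.antipode L (act g x) = act g (HopfAlgebra.antipode L x)

namespace GaloisHopfAction

variable {k L B} (σ : GaloisHopfAction k L B)

/-- The algebra of invariants. -/
def fixed : Subalgebra k B where
  carrier := {x | ∀ g, σ.act g x = x}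
  mul_mem' ha hb g := by rw [map_mul, ha, hb]
  one_mem' g := map_one _
  add_mem' ha hb g := by rw [map_add, ha, hb]
  zero_mem' g := map_zero _
  algebraMap_mem' r g := AlgHom.commutes _ _

lemma act_of_mem {x : B} (hx : x ∈ σ.fixed) (g : Gal(L/k)) : σ.act g x = x := hx g

lemma antipode_mem (x : σ.fixed) : HopfAlgebra.antipode L (x : B) ∈ σ.fixed := fun g => by
  rw [← antipode_act, σ.act_of_mem x.2]

variable [FiniteDimensional k L]

lemma sum_act_mem (x : B) : ∑ g, σ.act g x ∈ σ.fixed := fun h => by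
  rw [map_sum]
  exact Fintype.sum_equiv (Equiv.mulLeft h) _ _ fun g => by simp

/-- The trace `x ↦ ∑ g, g x`. -/
def trace : B →ₗ[k] σ.fixed :=
  (∑ g, (σ.act g).toLinearMap).codRestrict σ.fixed.toSubmodule fun x => by
    simpa using σ.sum_act_mem x

@[simp] lemma coe_trace (x : B) : (σ.trace x : B) = ∑ g, σ.act g x := by
  change (∑ g, (σ.act g).toLinearMap) x = _
  simp

lemma trace_smul_coe [IsGalois k L] (l : L) (x : σ.fixed) :
    σ.trace (l • (x : B)) = Algebra.trace k L l • x := by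
  ext
  rw [coe_trace, SetLike.val_smul, ← algebraMap_smul L (Algebra.trace k L l),
    trace_eq_sum_automorphisms, Finset.sum_smul]
  exact Finset.sum_congr rfl fun g _ => by rw [act_smul, σ.act_of_mem x.2]

lemma trace_mul_coe (x : B) (y : σ.fixed) : σ.trace (x * y) = σ.trace x * y := by
  ext
  rw [coe_trace, Subalgebra.coe_mul, coe_trace, Finset.sum_mul]
  exact Finset.sum_congr rfl fun g _ => by rw [map_mul, σ.act_of_mem y.2]

lemma isBaseChange_fixed [IsGalois k L] : IsBaseChange L σ.fixed.val.toLinearMap := by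
  classical
  obtain ⟨n, c, l, hcl⟩ := exists_sum_mul_apply_eq_ite k L
  let f : L ⊗[k] σ.fixed →ₗ[L] B :=
    TensorProduct.AlgebraTensorModule.lift
      ((LinearMap.toSpanSingleton L _ σ.fixed.val.toLinearMap))
  have hf (a : L) (x : σ.fixed) : f (a ⊗ₜ x) = a • (x : B) := rfl
  -- The inverse is `x ↦ ∑ cᵢ ⊗ tr(lᵢ x)`. Expanding the traces, the dual Dedekind relation keeps
  -- only the term `g = 1`.
  let r : B →ₗ[k] L ⊗[k] σ.fixed :=
    ∑ i, (TensorProduct.mk k L σ.fixed (c i)) ∘ₗ σ.trace ∘ₗ Algebra.lsmul k k B (l i)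
  have hr (x : B) : r x = ∑ i, c i ⊗ₜ σ.trace (l i • x) := by simp [r]
  have hfr (x : B) : f (r x) = x := by
    simp only [hr, map_sum, hf, coe_trace, act_smul, Finset.smul_sum]
    rw [Finset.sum_comm]
    simp only [smul_smul, ← Finset.sum_smul, hcl]
    simp
  have hrf (w : L ⊗[k] σ.fixed) : r (f w) = w := by
    induction w with
    | zero => simp
    | add a b ha hb => rw [map_add, map_add, ha, hb]
    | tmul a x =>
      simp only [hf, hr, smul_smul, trace_smul_coe]
      simp only [← TensorProduct.smul_tmul, ← TensorProduct.sum_tmul]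
      congr 1
      simp only [Algebra.smul_def, trace_eq_sum_automorphisms, map_mul, Finset.sum_mul]
      rw [Finset.sum_comm]
      have (g : Gal(L/k)) : ∑ i, g (l i) * g a * c i = (if g = 1 then 1 else 0) * g a := by
        rw [← hcl, Finset.sum_mul]
        exact Finset.sum_congr rfl fun i _ => by ring
      simp [this]
  exact IsBaseChange.of_equiv
    (LinearEquiv.ofBijective f ⟨Function.LeftInverse.injective hrf,
      Function.RightInverse.surjective hfr⟩) fun x => (hf 1 x).trans (one_smul L _)

/-- The diagonal sum `∑ g y ⊗ g z` equals `∑ᵢ tr(cᵢ y) ⊗ tr(lᵢ z)`: the coefficient of `g y ⊗ h z`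
in the latter is `∑ᵢ g(cᵢ) h(lᵢ) = δ_{g,h}`. -/
lemma sum_tensorRestrict_act_mem (w : B ⊗[k] B) :
    ∑ g, tensorRestrict L (σ.act g).toLinearMap (σ.act g).toLinearMap w ∈
      (tensorRestrict L σ.fixed.val.toLinearMap σ.fixed.val.toLinearMap).range := by
  classical
  obtain ⟨n, c, l, hcl⟩ := exists_sum_mul_apply_eq_ite k L
  induction w with
  | zero => simp
  | add a b ha hb => simpa only [map_add, Finset.sum_add_distrib] using add_mem ha hb
  | tmul y z =>
    refine ⟨∑ i, σ.trace (c i • y) ⊗ₜ σ.trace (l i • z), ?_⟩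
    have key (g h : Gal(L/k)) : ∑ i, g (c i) * h (l i) = if h = g then 1 else 0 := by
      have := congrArg g (hcl (g⁻¹ * h))
      simp only [map_sum, map_mul, ← AlgEquiv.mul_apply, mul_inv_cancel_left,
        apply_ite g, map_one, map_zero] at this
      simpa only [inv_mul_eq_one, eq_comm] using this
    have (i : Fin n) : tensorRestrict L σ.fixed.val.toLinearMap σ.fixed.val.toLinearMap
        (σ.trace (c i • y) ⊗ₜ σ.trace (l i • z)) =
        ∑ g, ∑ h, (g (c i) * h (l i)) • (σ.act g y ⊗ₜ[L] σ.act h z) := by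
      rw [tensorRestrict_tmul]
      simp only [AlgHom.toLinearMap_apply, Subalgebra.coe_val, coe_trace, act_smul,
        TensorProduct.sum_tmul, TensorProduct.tmul_sum, TensorProduct.smul_tmul_smul]
      exact Finset.sum_comm
    rw [map_sum]
    simp only [this]
    rw [Finset.sum_comm]
    refine Finset.sum_congr rfl fun g _ => ?_
    rw [Finset.sum_comm]
    simp only [← Finset.sum_smul, key]
    simp

/-- Choosing `a ∈ L` of trace `1` writes an invariant `x` as the trace of `a x`; its
comultiplication is then a diagonal sum over the Galois group. -/
lemma comul_mem [IsGalois k L] (x : σ.fixed) : Coalgebra.comul (R := L) (x : B) ∈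
    (tensorRestrict L σ.fixed.val.toLinearMap σ.fixed.val.toLinearMap).range := by
  obtain ⟨a, ha⟩ := Algebra.trace_surjective k L 1
  have h := congrArg Subtype.val (σ.trace_smul_coe a x)
  rw [ha, one_smul, coe_trace] at h
  obtain ⟨w, hw⟩ := σ.exists_comul_act (a • (x : B))
  rw [← h, map_sum]
  simp only [hw]
  exact σ.sum_tensorRestrict_act_mem w

lemma counit_mem [IsGalois k L] (x : σ.fixed) :
    ∃ r : k, algebraMap k L r = Coalgebra.counit (R := L) (x : B) :=
  (IsGalois.mem_range_algebraMap_iff_fixed _).2 fun g => by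
    rw [← counit_act, σ.act_of_mem x.2]

lemma tensorRestrict_fixed_injective [IsGalois k L] : Function.Injective
    (tensorRestrict L σ.fixed.val.toLinearMap σ.fixed.val.toLinearMap) := by
  have h := linearIndependent_of_isBaseChange σ.isBaseChange_fixed
    (Module.Basis.ofVectorSpace k σ.fixed)
  exact injective_of_linearIndependent_basis _ (linearIndependent_tensorRestrict h h)

/-- The comultiplication of the form of invariants. -/
def fixedComul [IsGalois k L] : σ.fixed →ₗ[k] σ.fixed ⊗[k] σ.fixed :=
  (LinearEquiv.ofInjective (tensorRestrict L σ.fixed.val.toLinearMap σ.fixed.val.toLinearMap)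
    σ.tensorRestrict_fixed_injective).symm ∘ₗ
    (((Coalgebra.comul (R := L) (A := B)).restrictScalars k) ∘ₗ
      σ.fixed.val.toLinearMap).codRestrict _ σ.comul_mem

/-- The counit of the form of invariants. -/
def fixedCounit [IsGalois k L] : σ.fixed →ₗ[k] k :=
  (LinearEquiv.ofInjective (Algebra.linearMap k L) (algebraMap k L).injective).symm ∘ₗ
    (((Coalgebra.counit (R := L) (A := B)).restrictScalars k) ∘ₗ
      σ.fixed.val.toLinearMap).codRestrict (Algebra.linearMap k L).range σ.counit_mem

/-- The invariants of a semilinear Galois action are a form of the Hopf algebra. -/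
def hopfForm [IsGalois k L] : HopfForm k L σ.fixed B where
  incl := σ.fixed.val
  isBaseChange := σ.isBaseChange_fixed
  comul := σ.fixedComul
  counit := σ.fixedCounit
  antipode := (((HopfAlgebra.antipode L (A := B)).restrictScalars k) ∘ₗ
    σ.fixed.val.toLinearMap).codRestrict σ.fixed.toSubmodule σ.antipode_mem
  tensorRestrict_comul _ := congrArg Subtype.val (LinearEquiv.apply_symm_apply
    (LinearEquiv.ofInjective (tensorRestrict L σ.fixed.val.toLinearMap σ.fixed.val.toLinearMap)
    σ.tensorRestrict_fixed_injective) _)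
  algebraMap_counit _ := congrArg Subtype.val (LinearEquiv.apply_symm_apply
    (LinearEquiv.ofInjective (Algebra.linearMap k L) (algebraMap k L).injective) _)
  incl_antipode _ := rfl

end GaloisHopfAction

/-! ### Twisted forms -/

open WithConv in
-- Both `f ∘ S` and `S ∘ f` are convolution inverses of `f`, one on the left and one on the right,
-- so they agree.
lemma antipode_map {R A A' : Type*} [CommSemiring R] [Semiring A] [Semiring A'] [HopfAlgebra R A]
    [HopfAlgebra R A'] (f : A →ₐc[R] A') (x : A) :
    HopfAlgebra.antipode R (f x) = f (HopfAlgebra.antipode R x) := by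
  have h1 : toConv (f.toLinearMap ∘ₗ HopfAlgebra.antipode R) * toConv f.toLinearMap = 1 := by
    have := LinearMap.algHom_comp_convMul_distrib (f : A →ₐ[R] A')
      (toConv (HopfAlgebra.antipode R)) (toConv LinearMap.id)
    rw [LinearMap.antipode_mul_id, LinearMap.algHom_comp_convOne] at this
    exact (ofConv_injective this).symm
  have h2 : toConv f.toLinearMap * toConv (HopfAlgebra.antipode R ∘ₗ f.toLinearMap) = 1 := by
    have := LinearMap.convMul_comp_coalgHom_distrib (toConv LinearMap.id)
      (toConv (HopfAlgebra.antipode R)) (f : A →ₗc[R] A')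
    rw [LinearMap.id_mul_antipode, LinearMap.convOne_comp_coalgHom] at this
    exact (ofConv_injective this).symm
  exact (LinearMap.congr_fun (congrArg ofConv (left_inv_eq_right_inv h1 h2)) x).symm

variable {k} {C : Type*} [Ring C] [HopfAlgebra k C]

/-- The semilinear action on `L ⊗[k] C` given by an action of `Gal(L/k)` on `C`. -/
def twistAction (ρ : Gal(L/k) →* (C →ₐc[k] C)) : GaloisHopfAction k L (L ⊗[k] C) where
  act :=
    { toFun g := Algebra.TensorProduct.map (g : L →ₐ[k] L) (ρ g : C →ₐ[k] C)
      map_one' := by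
        ext <;> simp
      map_mul' g h := by
        ext <;> simp }
  act_smul g l x := by
    induction x with
    | zero => simp
    | add a b ha hb => simp only [smul_add, map_add, ha, hb]
    | tmul a c => simp [TensorProduct.smul_tmul']
  exists_comul_act x := by
    induction x with
    | zero => exact ⟨0, by simp⟩
    | add a b ha hb =>
      obtain ⟨v, hv⟩ := ha
      obtain ⟨w, hw⟩ := hb
      exact ⟨v + w, fun g => by rw [map_add, map_add, map_add, hv, hw]⟩
    | tmul a c =>
      -- The lift of `Δ(a ⊗ c)` is `∑ (1 ⊗ c₁) ⊗ (a ⊗ c₂)`; the whole scalar sits in the second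
      -- factor.
      refine ⟨TensorProduct.map (TensorProduct.mk k L C 1) (TensorProduct.mk k L C a)
        (Coalgebra.comul c), fun g => ?_⟩
      have key (w : C ⊗[k] C) :
          TensorProduct.AlgebraTensorModule.tensorTensorTensorComm k L k L L L C C
            (Coalgebra.comul (R := L) (g a) ⊗ₜ
              TensorProduct.map (ρ g : C →ₗ[k] C) (ρ g : C →ₗ[k] C) w) =
          tensorRestrict L
            (Algebra.TensorProduct.map (g : L →ₐ[k] L) (ρ g : C →ₐ[k] C)).toLinearMap
            (Algebra.TensorProduct.map (g : L →ₐ[k] L) (ρ g : C →ₐ[k] C)).toLinearMap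
            (TensorProduct.map (TensorProduct.mk k L C 1) (TensorProduct.mk k L C a) w) := by
        induction w with
        | zero => simp
        | add x y hx hy => simp only [TensorProduct.tmul_add, map_add, hx, hy]
        | tmul x y => simp
      refine Eq.trans ?_ (key _)
      rw [CoalgHomClass.map_comp_comul_apply]
      rfl
  counit_act g x := by
    induction x with
    | zero => simp
    | add a b ha hb => simp only [map_add, ha, hb]
    | tmul a c => simp
  antipode_act g x := by
    induction x with
    | zero => simp
    | add a b ha hb => simp only [map_add, ha, hb]
    | tmul a c => simp [antipode_map]

end Descent

/-! ### Automorphisms of the semidirect product -/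

namespace SemidirectHopf

section Map

variable {k : Type*} [CommRing k] {T N : Type*} [Group T] [Group N] [Fintype T]
  {ψ : N →* MulAut T}

/-- The endomorphism of `k[T] ⋊ kN` induced by an automorphism of `T` that commutes with `N`. -/
def mapAut (θ : MulAut T) (hθ : ∀ n t, θ (ψ n t) = ψ n (θ t)) :
    SemidirectHopf k ψ →ₐc[k] SemidirectHopf k ψ :=
  letI f : SemidirectHopf k ψ →ₗ[k] SemidirectHopf k ψ :=
    (basis k ψ).constr k fun p => basis k ψ (θ p.1, p.2)
  have hf p : f (basis k ψ p) = basis k ψ (θ p.1, p.2) := (basis k ψ).constr_basis ..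
  have hmul (a b : SemidirectHopf k ψ) : f (a * b) = f a * f b := by
    classical
    induction a using induction_basis with
    | zero => simp
    | add a a' h h' => simp only [add_mul, map_add, h, h']
    | smul r a h => simp only [smul_mul_assoc, map_smul, h]
    | basis p =>
    induction b using induction_basis with
    | zero => simp
    | add b b' h h' => simp only [mul_add, map_add, h, h']
    | smul r a h => simp only [mul_smul_comm, map_smul, h]
    | basis q =>
      simp only [hf, basis_mul_basis, apply_ite f, map_zero, ← hθ, θ.injective.eq_iff]
  BialgHom.ofAlgHom
    (AlgHom.ofLinearMap f
      (by
        simp only [one_def, map_sum, hf]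
        exact Fintype.sum_equiv θ.toEquiv _ _ fun t => rfl) hmul)
    (by
      classical
      refine AlgHom.toLinearMap_injective ((basis k ψ).ext fun p => ?_)
      change Coalgebra.counit (R := k) (f _) = Coalgebra.counit (R := k) _
      simp [hf, counit_basis])
    (by
      refine AlgHom.toLinearMap_injective ((basis k ψ).ext fun p => ?_)
      change TensorProduct.map f f (Coalgebra.comul (R := k) _) = Coalgebra.comul (R := k) (f _)
      simp only [hf, comul_basis, map_sum, TensorProduct.map_tmul]
      exact Fintype.sum_equiv θ.toEquiv _ _ fun t => by simp)

@[simp]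
lemma mapAut_basis (θ : MulAut T) (hθ : ∀ n t, θ (ψ n t) = ψ n (θ t)) (p : T × N) :
    mapAut (k := k) θ hθ (basis k ψ p) = basis k ψ (θ p.1, p.2) :=
  (basis k ψ).constr_basis k _ p

/-- The action on `k[T] ⋊ kN` of a group that acts on `T` by automorphisms commuting with `N`. -/
def mapHom {G : Type*} [Group G] (θ : G →* MulAut T) (hθ : ∀ g n t, θ g (ψ n t) = ψ n (θ g t)) :
    G →* (SemidirectHopf k ψ →ₐc[k] SemidirectHopf k ψ) where
  toFun g := mapAut (θ g) (hθ g)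
  map_one' := by
    refine BialgHom.coe_linearMap_injective ((basis k ψ).ext fun p => ?_)
    simp
  map_mul' g h := by
    refine BialgHom.coe_linearMap_injective ((basis k ψ).ext fun p => ?_)
    simp

@[simp]
lemma mapHom_basis {G : Type*} [Group G] (θ : G →* MulAut T)
    (hθ : ∀ g n t, θ g (ψ n t) = ψ n (θ g t)) (g : G) (p : T × N) :
    mapHom (k := k) θ hθ g (basis k ψ p) = basis k ψ (θ g p.1, p.2) :=
  mapAut_basis _ (hθ g) p

end Map

end SemidirectHopf

/-! ### The right action on `ℤ₂G` -/

section RightMul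

variable {G : Type*} [Group G]

/-- The action of `G` on `ℤ₂G` that sends a basis vector `h` to `h g⁻¹`. -/
def rightMul : G →* MulAut (Z2Group G) where
  toFun g :=
    { toFun t := Multiplicative.ofAdd fun h => Multiplicative.toAdd t (h * g)
      invFun t := Multiplicative.ofAdd fun h => Multiplicative.toAdd t (h * g⁻¹)
      left_inv t := by simp; rfl
      right_inv t := by simp; rfl
      map_mul' s t := rfl }
  map_one' := by ext t; simp; rfl
  map_mul' g g' := MulEquiv.ext fun t => congrArg Multiplicative.ofAdd (funext fun h =>
    congrArg (Multiplicative.toAdd t) (mul_assoc h g g').symm)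

lemma rightMul_leftMul (g h : G) (t : Z2Group G) :
    rightMul g (leftMul h t) = leftMul h (rightMul g t) :=
  congrArg Multiplicative.ofAdd (funext fun j =>
    congrArg (Multiplicative.toAdd t) (mul_assoc h⁻¹ j g).symm)

variable (G) in
open Classical in
/-- The basis vector `1` of `ℤ₂G`. -/
def deltaOne : Z2Group G := Multiplicative.ofAdd (Pi.single 1 1)

lemma leftMul_rightMul_deltaOne (g : G) : leftMul g (rightMul g (deltaOne G)) = deltaOne G := by
  classical
  refine congrArg Multiplicative.ofAdd (funext fun h => ?_)
  change (Pi.single 1 1 : G → ZMod 2) (g⁻¹ * h * g) = (Pi.single 1 1 : G → ZMod 2) h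
  have : g⁻¹ * h * g = 1 ↔ h = 1 := by
    rw [mul_eq_one_iff_eq_inv, mul_eq_left]
  simp [Pi.single_apply, this]

/-- Trivial stabilizer of `δ₁`: this is the property of `ℤ₂G` that makes the evaluation map
surjective. -/
lemma rightMul_deltaOne_eq_iff (g : G) : rightMul g (deltaOne G) = deltaOne G ↔ g = 1 := by
  classical
  refine ⟨fun e => ?_, by rintro rfl; simp⟩
  have h := congrFun (congrArg Multiplicative.toAdd e) 1
  change (Pi.single 1 1 : G → ZMod 2) (1 * g) = (Pi.single 1 1 : G → ZMod 2) 1 at h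
  by_contra hg
  simp [hg] at h

end RightMul

/-! ### Maschke's theorem for a ring generated by a normalized subring -/

section Maschke

variable {R A N : Type*} [Ring R] [Ring A] [IsSemisimpleRing A] [Group N] [Finite N]

/-- If a ring is generated additively by the products `i a * u n`, where `i : A → R` is a
homomorphism from a semisimple ring, `u` is a homomorphism from a finite group of invertible order
to the units of `R` that normalizes the image of `i`, then it is semisimple. -/
theorem isSemisimpleRing_of_normalized (i : A →+* R) (u : N →* Rˣ)
    (hN : IsUnit (Nat.card N : R)) (hnorm : ∀ n a, ∃ a', (u n : R) * i a = i a' * u n)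
    (hgen : AddSubgroup.closure {x : R | ∃ a n, x = i a * u n} = ⊤) : IsSemisimpleRing R := by
  have := Fintype.ofFinite N
  let : Module A R := Module.compHom R i
  have smul_eq (a : A) (x : R) : a • x = i a * x := rfl
  have : IsScalarTower A R R := ⟨fun a x y => mul_assoc (i a) x y⟩
  refine (isSemisimpleModule_iff R R).2 ⟨fun W => ?_⟩
  obtain ⟨W', hW'⟩ := exists_isCompl (W.restrictScalars A)
  let p : R →ₗ[A] W.restrictScalars A := Submodule.projectionOnto _ _ hW'
  obtain ⟨c, hc⟩ := hN
  have hcomm (x : R) : (↑c⁻¹ : R) * x = x * ↑c⁻¹ := by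
    have : Commute (c : R) x := by rw [hc]; exact Nat.cast_commute _ _
    exact this.units_inv_left.eq
  -- Maschke averaging of an `A`-linear projection onto `W`. On `W` the sum is multiplication by
  -- `|N|`, hence the final division by `c`.
  let q : R →+ R := ∑ n : N, (AddMonoidHom.mulLeft (u n : R)).comp
    (((W.restrictScalars A).subtype ∘ₗ p).toAddMonoidHom.comp (AddMonoidHom.mulLeft (u n⁻¹ : R)))
  have hq (x : R) : q x = ∑ n : N, (u n : R) * (p ((u n⁻¹ : R) * x) : R) := by
    simp [q]
  have hqW (x : R) : q x ∈ W := by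
    rw [hq]
    exact sum_mem fun n _ => W.smul_mem (u n : R) (p _).2
  have hqid (x : R) (hx : x ∈ W) : q x = c * x := by
    rw [hq, hc, Nat.card_eq_fintype_card, Finset.card_univ.symm, ← nsmul_eq_mul,
      ← Finset.sum_const]
    refine Finset.sum_congr rfl fun n _ => ?_
    have h1 : ((u n⁻¹ : R) * x) ∈ W := W.smul_mem (u n⁻¹ : R) hx
    have h2 : p ((u n⁻¹ : R) * x) = ⟨_, h1⟩ :=
      Submodule.projectionOnto_apply_left hW' ⟨_, h1⟩
    rw [h2]
    change (u n : R) * ((u n⁻¹ : R) * x) = x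
    rw [map_inv, Units.mul_inv_cancel_left]
  have hqu (n : N) (x : R) : q (u n * x) = u n * q x := by
    rw [hq, hq, Finset.mul_sum]
    refine Fintype.sum_equiv (Equiv.mulLeft n⁻¹) _ _ fun m => ?_
    simp [mul_assoc]
  -- Each summand separately commutes with `i a`: moving `i a` past `u n⁻¹` turns it into some `i
  -- a'`, which passes through `p` by `A`-linearity and is turned back by `u n`.
  have hqi (a : A) (x : R) : q (i a * x) = i a * q x := by
    rw [hq, hq, Finset.mul_sum]
    refine Finset.sum_congr rfl fun n _ => ?_
    obtain ⟨a', ha'⟩ := hnorm n⁻¹ a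
    have h1 : (u n⁻¹ : R) * (i a * x) = a' • ((u n⁻¹ : R) * x) := by
      rw [smul_eq, ← mul_assoc, ha', mul_assoc]
    have h2 : (u n : R) * i a' = i a * u n := by
      rw [map_inv] at ha'
      rw [← Units.mul_inv_cancel_left (u n) (i a * u n), ← mul_assoc _ (i a), ha', mul_assoc,
        Units.inv_mul, mul_one]
    rw [h1, map_smul]
    change (u n : R) * (i a' * _) = _
    rw [← mul_assoc, h2, mul_assoc]
  have hlin (r x : R) : q (r * x) = r * q x := by
    have hr : r ∈ AddSubgroup.closure {x : R | ∃ a n, x = i a * u n} := hgen ▸ AddSubgroup.mem_top r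
    induction hr using AddSubgroup.closure_induction with
    | mem r hr => obtain ⟨a, n, rfl⟩ := hr; rw [mul_assoc, hqi, hqu, mul_assoc]
    | zero => simp
    | add r s _ _ hr hs => simp only [add_mul, map_add, hr, hs]
    | neg r _ hr => simp only [neg_mul, map_neg, hr]
  let f : R →ₗ[R] W :=
    { toFun x := ⟨(↑c⁻¹ : R) * q x, W.smul_mem _ (hqW x)⟩
      map_add' x y := by ext; simp [mul_add]
      map_smul' r x := by
        ext
        change (↑c⁻¹ : R) * q (r * x) = r * (↑c⁻¹ * q x)
        rw [hlin, ← mul_assoc, hcomm, mul_assoc] }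
  exact ⟨_, LinearMap.isCompl_of_proj (f := f) fun x => Subtype.ext (by
    change (↑c⁻¹ : R) * q x = x
    rw [hqid _ x.2, Units.inv_mul_cancel_left])⟩

end Maschke

/-! ### The group `Ĝ` -/

namespace CrossedProduct

variable {k L : Type*} [Field k] [Field L] [Algebra k L]
  {α : Gal(L/k) × Gal(L/k) → Lˣ} {hα : groupCohomology.IsMulCocycle₂ α}

variable (hα) in
/-- The embedding of `L` into the crossed product algebra. -/
def embed : L →ₐ[k] CrossedProduct α hα :=
  AlgHom.ofLinearMap (single hα 1 ∘ₗ LinearMap.mulRight k (↑(α (1, 1))⁻¹ : L))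
    (by simp [one_def])
    (by
      intro x y
      simp only [LinearMap.comp_apply, LinearMap.mulRight_apply, single_mul_single, one_mul]
      congr 1
      simp
      field_simp)

lemma embed_apply (x : L) : embed hα x = single hα 1 (x * ↑(α (1, 1))⁻¹) := rfl

lemma embed_injective : Function.Injective (embed hα) := fun x y e => by
  have := Finsupp.single_injective (1 : Gal(L/k)) e
  exact mul_right_cancel₀ (Units.ne_zero _) this

@[simp]
lemma embed_mul_single (x y : L) (g : Gal(L/k)) :
    embed hα x * single hα g y = single hα g (x * y) := by
  rw [embed_apply, single_mul_single, one_mul, groupCohomology.map_one_fst_of_isMulCocycle₂ hα g]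
  congr 1
  simp
  field_simp

lemma single_mul_embed (x y : L) (g : Gal(L/k)) :
    single hα g y * embed hα x = embed hα (g x) * single hα g y := by
  rw [embed_mul_single, embed_apply, single_mul_single, mul_one,
    congrArg Units.val (groupCohomology.map_one_snd_of_isMulCocycle₂ hα g)]
  congr 1
  simp [AlgEquiv.smul_units_def]
  field_simp

/-- The `m`-th roots of unity are Galois stable and contain the values of `α`, so products and
inverses of the `U_g` have coefficients among them. -/
lemma exists_pow_eq_one_of_mem_Ghat {m : ℕ} (hm : ∀ g h, α (g, h) ^ m = 1)
    {u : (CrossedProduct α hα)ˣ} (hu : u ∈ Ghat α hα) :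
    ∃ g : Gal(L/k), ∃ x : Lˣ, x ^ m = 1 ∧ u = unitSingle hα g x := by
  have hsmul (g : Gal(L/k)) {x : Lˣ} (hx : x ^ m = 1) : (g • x) ^ m = 1 := by
    rw [← smul_pow', hx, smul_one]
  induction hu using Subgroup.closure_induction with
  | mem u hu => obtain ⟨g, rfl⟩ := hu; exact ⟨g, 1, one_pow _, rfl⟩
  | one => exact ⟨1, (α (1, 1))⁻¹, by simp [hm], Units.ext one_def⟩
  | mul u v _ _ hu hv =>
    obtain ⟨g, x, hx, rfl⟩ := hu
    obtain ⟨h, y, hy, rfl⟩ := hv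
    exact ⟨g * h, x * g • y * α (g, h),
      by rw [mul_pow, mul_pow, hx, hsmul g hy, hm, one_mul, one_mul],
      Units.ext (single_mul_single g h (x : L) (y : L))⟩
  | inv u _ hu =>
    obtain ⟨g, x, hx, rfl⟩ := hu
    exact ⟨g⁻¹, (g⁻¹ • x)⁻¹ * (α (g⁻¹, g))⁻¹ * (α (1, 1))⁻¹,
      by rw [mul_pow, mul_pow, inv_pow, inv_pow, inv_pow, hsmul g⁻¹ hx, hm, hm]; simp, Units.ext rfl⟩

lemma finite_Ghat [FiniteDimensional k L] (hfin : ∀ g h : Gal(L/k), IsOfFinOrder (α (g, h))) :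
    Finite (Ghat α hα) := by
  classical
  -- A common nonzero exponent for all values of `α`; the coefficients then lie in the finite group
  -- of `m`-th roots of unity.
  let m := ∏ p : Gal(L/k) × Gal(L/k), orderOf (α p)
  have hm0 : m ≠ 0 := Finset.prod_ne_zero_iff.2 fun p _ => (hfin p.1 p.2).orderOf_pos.ne'
  have hm (g h : Gal(L/k)) : α (g, h) ^ m = 1 :=
    orderOf_dvd_iff_pow_eq_one.1 (Finset.dvd_prod_of_mem _ (Finset.mem_univ (g, h)))
  have : NeZero m := ⟨hm0⟩
  let f : Gal(L/k) × rootsOfUnity m L → (CrossedProduct α hα)ˣ :=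
    fun p => unitSingle hα p.1 p.2
  refine Set.Finite.subset (Set.finite_range f) fun u hu => ?_
  obtain ⟨g, x, hx, rfl⟩ := exists_pow_eq_one_of_mem_Ghat hm hu
  exact ⟨(g, ⟨x, hx⟩), rfl⟩

/-- If the characteristic does not divide the order of the Galois group, it does not divide the
order of `Ĝ`. -/
lemma natCast_card_Ghat_ne_zero [FiniteDimensional k L] [Finite (Ghat α hα)]
    (hG : ¬ ringChar k ∣ Nat.card Gal(L/k)) : (Nat.card (Ghat α hα) : k) ≠ 0 := by
  intro h0
  have hdvd := (ringChar.spec k _).1 h0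
  rcases CharP.char_is_prime_or_zero k (ringChar k) with hp | hp
  · have := Fact.mk hp
    rw [← Subgroup.card_mul_index (proj α hα).ker, hp.dvd_mul] at hdvd
    rcases hdvd with h | h
    · obtain ⟨u, hu⟩ := exists_prime_orderOf_dvd_card' (ringChar k) h
      obtain ⟨x, hx⟩ := exists_eq_single_proj u.1
      rw [MonoidHom.mem_ker.1 u.2] at hx
      have hu1 : embed hα (x * α (1, 1)) =
          ((u.1 : (CrossedProduct α hα)ˣ) : CrossedProduct α hα) := by
        rw [hx, embed_apply, mul_assoc, Units.mul_inv, mul_one]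
      have hup : embed hα ((x * α (1, 1)) ^ ringChar k) = embed hα 1 := by
        rw [map_pow, hu1, map_one]
        have := congrArg (fun v : (proj α hα).ker =>
          ((v.1 : (CrossedProduct α hα)ˣ) : CrossedProduct α hα)) (pow_orderOf_eq_one u)
        rw [hu] at this
        simpa using this
      have : CharP L (ringChar k) := charP_of_injective_algebraMap (algebraMap k L).injective _
      have h1 : (x * α (1, 1) : L) = 1 := by
        refine frobenius_inj L (ringChar k) ?_
        simpa [frobenius_def] using embed_injective hup
      rw [h1, map_one] at hu1
      have : u = 1 := Subtype.ext (Subtype.ext (Units.ext hu1.symm))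
      rw [this, orderOf_one] at hu
      exact hp.one_lt.ne hu
    · refine hG (h.trans ?_)
      rw [Subgroup.index_ker]
      exact Subgroup.card_subgroup_dvd_card _
  · rw [hp, zero_dvd_iff] at hdvd
    exact Nat.card_pos.ne' hdvd

end CrossedProduct

/-! ### Functions and group elements in the semidirect product -/

namespace SemidirectHopf

section Generators

variable {k : Type*} [CommRing k] {T N : Type*} [Group T] [Group N] [Fintype T]
  {ψ : N →* MulAut T}

variable (k ψ) in
/-- The embedding `n ↦ 1 ⊗ n` of the group `N`. -/
def ofGroup : N →* SemidirectHopf k ψ where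
  toFun n := ∑ t, basis k ψ (t, n)
  map_one' := rfl
  map_mul' n m := by
    classical
    rw [Finset.sum_mul_sum]
    refine Finset.sum_congr rfl fun t _ => ?_
    simp [basis_mul_basis, ← MulEquiv.symm_apply_eq]

lemma ofGroup_apply (n : N) : ofGroup k ψ n = ∑ t, basis k ψ (t, n) := rfl

lemma ofGroup_mul_basis (n : N) (p : T × N) :
    ofGroup k ψ n * basis k ψ p = basis k ψ (ψ n p.1, n * p.2) := by
  classical
  simp [ofGroup_apply, Finset.sum_mul, basis_mul_basis]

lemma basis_mul_ofGroup (p : T × N) (n : N) :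
    basis k ψ p * ofGroup k ψ n = basis k ψ (p.1, p.2 * n) := by
  classical
  simp [ofGroup_apply, Finset.mul_sum, basis_mul_basis, ← MulEquiv.symm_apply_eq]

variable (L : Type*) [CommRing L] [Algebra k L]

variable (k ψ) in
/-- The embedding of the function algebra `L[T]`. -/
def ofFun : (T → L) →ₐ[k] L ⊗[k] SemidirectHopf k ψ :=
  AlgHom.ofLinearMap
    (∑ t, (TensorProduct.mk k L (SemidirectHopf k ψ)).flip (basis k ψ (t, 1)) ∘ₗ LinearMap.proj t)
    (by simp [Algebra.TensorProduct.one_def, one_def, TensorProduct.tmul_sum])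
    (by
      classical
      intro f f'
      simp [Finset.sum_mul_sum, basis_mul_basis, TensorProduct.tmul_ite])

variable {L}

lemma ofFun_apply (f : T → L) : ofFun k ψ L f = ∑ t, f t ⊗ₜ basis k ψ (t, 1) := by
  simp [ofFun]

open Classical in
lemma ofFun_single (t : T) (l : L) : ofFun k ψ L (Pi.single t l) = l ⊗ₜ basis k ψ (t, 1) := by
  rw [ofFun_apply, Fintype.sum_eq_single t]
  · simp
  · intro s hs
    simp [hs]

lemma ofGroup_mul_ofFun (n : N) (f : T → L) :
    ((1 : L) ⊗ₜ ofGroup k ψ n) * ofFun k ψ L f =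
      ofFun k ψ L (fun t => f ((ψ n).symm t)) * ((1 : L) ⊗ₜ ofGroup k ψ n) := by
  simp only [ofFun_apply, Finset.mul_sum, Finset.sum_mul, Algebra.TensorProduct.tmul_mul_tmul,
    ofGroup_mul_basis, basis_mul_ofGroup, one_mul, mul_one]
  exact Fintype.sum_equiv (ψ n).toEquiv _ _ fun t => by simp

end Generators

end SemidirectHopf

/-! ### The form of the semidirect product -/

section Main

open SemidirectHopf CrossedProduct

variable {k L : Type*} [Field k] [Field L] [Algebra k L] [FiniteDimensional k L]
  (α : Gal(L/k) × Gal(L/k) → Lˣ) (hα : groupCohomology.IsMulCocycle₂ α)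

/-- The semilinear action of `Gal(L/k)` on `L ⊗[k] (k[T] ⋊ kĜ)` through right multiplication
on `T = ℤ₂G`. -/
def splitAction : GaloisHopfAction k L (L ⊗[k] SplitHopf α hα) :=
  twistAction L (mapHom rightMul fun g n t => rightMul_leftMul g (proj α hα n) t)

variable {α hα}

@[simp]
lemma splitAction_act_tmul (g : Gal(L/k)) (l : L) (p : Z2Group Gal(L/k) × Ghat α hα) :
    (splitAction α hα).act g (l ⊗ₜ basis k _ p) = g l ⊗ₜ basis k _ (rightMul g p.1, p.2) := by
  change Algebra.TensorProduct.map _ _ _ = _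
  simp

lemma one_tmul_ofGroup_mem (n : Ghat α hα) :
    (1 : L) ⊗ₜ[k] ofGroup k _ n ∈ (splitAction α hα).fixed := fun g => by
  rw [ofGroup_apply, TensorProduct.tmul_sum, map_sum]
  simp only [splitAction_act_tmul, map_one]
  exact Fintype.sum_equiv (rightMul g).toEquiv _ _ fun t => rfl

lemma splitAction_act_ofFun (g : Gal(L/k)) (f : Z2Group Gal(L/k) → L) :
    (splitAction α hα).act g (ofFun k _ L f) =
      ofFun k _ L fun t => g (f ((rightMul g).symm t)) := by
  rw [ofFun_apply, ofFun_apply, map_sum]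
  simp only [splitAction_act_tmul]
  exact Fintype.sum_equiv (rightMul g).toEquiv _ _ fun t => by simp

open Classical in
variable (α hα) in
/-- The linear map `L ⊗[k] (k[T] ⋊ kĜ) → L^α_t G` that evaluates functions on `T` at the basis
vector `1`. -/
def evalMap : L ⊗[k] SplitHopf α hα →ₗ[k] CrossedProduct α hα :=
  LinearMap.mul' k _ ∘ₗ TensorProduct.map (embed hα).toLinearMap
    ((basis k _).constr k fun p =>
      if p.1 = deltaOne Gal(L/k) then ((p.2 : (CrossedProduct α hα)ˣ) : CrossedProduct α hα) else 0)

open Classical in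
lemma evalMap_tmul_basis (l : L) (p : Z2Group Gal(L/k) × Ghat α hα) :
    evalMap α hα (l ⊗ₜ basis k _ p) = if p.1 = deltaOne Gal(L/k) then
      embed hα l * ((p.2 : (CrossedProduct α hα)ˣ) : CrossedProduct α hα) else 0 := by
  simp [evalMap]

lemma evalMap_one : evalMap α hα 1 = 1 := by
  classical
  rw [Algebra.TensorProduct.one_def, SemidirectHopf.one_def, TensorProduct.tmul_sum, map_sum]
  simp [evalMap_tmul_basis]

lemma induction_tmul_basis {P : L ⊗[k] SplitHopf α hα → Prop} (x : L ⊗[k] SplitHopf α hα)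
    (zero : P 0) (add : ∀ x y, P x → P y → P (x + y))
    (tmul : ∀ l p, P (l ⊗ₜ basis k _ p)) : P x := by
  induction x with
  | zero => exact zero
  | add x y hx hy => exact add x y hx hy
  | tmul l c =>
    induction c using induction_basis generalizing l with
    | zero => simpa using zero
    | add a b ha hb => simpa [TensorProduct.tmul_add] using add _ _ (ha l) (hb l)
    | smul r a ha => simpa [TensorProduct.smul_tmul] using ha (r • l)
    | basis p => exact tmul l p

/-- With `g = π(n)`, the product picks out the `s` with `g s g⁻¹ = δ₁`, that is `s = δ₁`. The Galois
twist of the coefficient `c` of `y` matches `n c = g(c) n` in the crossed product. -/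
lemma evalMap_mul_act (l : L) (p : Z2Group Gal(L/k) × Ghat α hα) (y : L ⊗[k] SplitHopf α hα) :
    evalMap α hα ((l ⊗ₜ basis k _ p) * (splitAction α hα).act (proj α hα p.2) y) =
      evalMap α hα (l ⊗ₜ basis k _ p) * evalMap α hα y := by
  classical
  induction y using induction_tmul_basis with
  | zero => simp
  | add x y hx hy => simp only [map_add, mul_add, hx, hy]
  | tmul c q =>
    obtain ⟨t, n⟩ := p
    obtain ⟨s, m⟩ := q
    rw [splitAction_act_tmul, Algebra.TensorProduct.tmul_mul_tmul, basis_mul_basis]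
    by_cases ht : t = deltaOne Gal(L/k)
    · have h1 : t = leftMul (proj α hα n) (rightMul (proj α hα n) s) ↔ s = deltaOne _ := by
        rw [ht, ← leftMul_rightMul_deltaOne (proj α hα n), EquivLike.apply_eq_iff_eq,
          EquivLike.apply_eq_iff_eq, eq_comm, leftMul_rightMul_deltaOne]
      obtain ⟨x, hx⟩ := exists_eq_single_proj n
      by_cases hs : s = deltaOne _
      · simp only [MonoidHom.comp_apply, leftMul_rightMul_deltaOne, if_true, evalMap_tmul_basis, ht,
          hs]
        rw [Subgroup.coe_mul, Units.val_mul, hx, map_mul, mul_assoc, mul_assoc,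
          ← mul_assoc (embed hα (proj α hα n c)), ← single_mul_embed, mul_assoc]
      · have h2 := mt h1.1 hs
        simp only [MonoidHom.comp_apply, h2, if_false, evalMap_tmul_basis, hs]
        simp
    · rw [evalMap_tmul_basis, if_neg ht, zero_mul]
      split_ifs
      · rw [evalMap_tmul_basis, if_neg ht]
      · simp

lemma evalMap_mul (x : L ⊗[k] SplitHopf α hα) {y : L ⊗[k] SplitHopf α hα}
    (hy : y ∈ (splitAction α hα).fixed) :
    evalMap α hα (x * y) = evalMap α hα x * evalMap α hα y := by
  induction x using induction_tmul_basis with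
  | zero => simp
  | add a b ha hb => simp only [map_add, add_mul, ha, hb]
  | tmul l p =>
    rw [← evalMap_mul_act, (splitAction α hα).act_of_mem hy]

variable (α hα) in
/-- The homomorphism from the form to the crossed product algebra. -/
def evalHom : (splitAction α hα).fixed →ₐ[k] CrossedProduct α hα :=
  AlgHom.ofLinearMap (evalMap α hα ∘ₗ (splitAction α hα).fixed.val.toLinearMap)
    evalMap_one fun x y => evalMap_mul x.1 y.2

lemma evalHom_surjective : Function.Surjective (evalHom α hα) := by
  classical
  intro z
  change z ∈ (evalHom α hα).range
  induction z using induction_single with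
  | zero => exact zero_mem _
  | add a b ha hb => exact add_mem ha hb
  | single g x =>
    let n : Ghat α hα := ⟨unitSingle hα g 1, Subgroup.subset_closure ⟨g, rfl⟩⟩
    -- Only the term `g = 1` of the trace is supported at `δ₁`, so evaluation returns `x U_g`.
    refine ⟨(splitAction α hα).trace (x ⊗ₜ basis k _ (deltaOne _, n)), ?_⟩
    change evalMap α hα ((splitAction α hα).trace _).1 = _
    rw [GaloisHopfAction.coe_trace, map_sum]
    simp only [splitAction_act_tmul, evalMap_tmul_basis, rightMul_deltaOne_eq_iff]
    rw [Finset.sum_ite_eq' Finset.univ (1 : Gal(L/k)), if_pos (Finset.mem_univ _)]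
    exact (embed_mul_single x 1 g).trans (by rw [mul_one])

variable (α hα) in
/-- The functions on `T` that lie in the form. -/
def fixedFun : Subalgebra k (Z2Group Gal(L/k) → L) :=
  (splitAction α hα).fixed.comap (ofFun k _ L)

/-- A finite-dimensional subalgebra of a product of copies of the field `L` is commutative, reduced
and Artinian, in any characteristic. -/
lemma isSemisimpleRing_fixedFun : IsSemisimpleRing (fixedFun α hα) := by
  have : IsReduced (fixedFun α hα) :=
    isReduced_of_injective (fixedFun α hα).val Subtype.val_injective
  have : IsArtinianRing (fixedFun α hα) := IsArtinianRing.of_finite k _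
  exact IsArtinianRing.isSemisimpleRing_of_isReduced _

variable (α hα) in
/-- The embedding of the invariant functions on `T` into the form. -/
def fixedFunIncl : fixedFun α hα →ₐ[k] (splitAction α hα).fixed :=
  ((ofFun k _ L).comp (fixedFun α hα).val).codRestrict _ fun f => f.2

variable (α hα) in
/-- The embedding of `Ĝ` into the form. -/
def groupIncl : Ghat α hα →* (splitAction α hα).fixed where
  toFun n := ⟨(1 : L) ⊗ₜ ofGroup k _ n, one_tmul_ofGroup_mem n⟩
  map_one' := by ext; simp [Algebra.TensorProduct.one_def]
  map_mul' n m := by ext; simp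

lemma coe_fixedFunIncl (f : fixedFun α hα) :
    (fixedFunIncl α hα f : L ⊗[k] SplitHopf α hα) = ofFun k _ L f := rfl

lemma coe_groupIncl (n : Ghat α hα) :
    (groupIncl α hα n : L ⊗[k] SplitHopf α hα) = (1 : L) ⊗ₜ ofGroup k _ n := rfl

lemma exists_groupIncl_mul_fixedFunIncl (n : Ghat α hα) (f : fixedFun α hα) :
    ∃ f', groupIncl α hα n * fixedFunIncl α hα f = fixedFunIncl α hα f' * groupIncl α hα n := by
  have key := ofGroup_mul_ofFun n f.1 (k := k)
    (ψ := (leftMul (G := Gal(L/k))).comp (proj α hα))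
  refine ⟨⟨fun t => f.1 ((leftMul (proj α hα n)).symm t), ?_⟩, Subtype.ext key⟩
  -- The translated function is the conjugate `n f n⁻¹` of invariant elements, hence itself
  -- invariant.
  have h1 : ofFun k _ L (fun t => f.1 ((leftMul (proj α hα n)).symm t)) =
      ((groupIncl α hα n * fixedFunIncl α hα f * groupIncl α hα n⁻¹ : (splitAction α hα).fixed) :
        L ⊗[k] SplitHopf α hα) := by
    rw [Subalgebra.coe_mul, Subalgebra.coe_mul, coe_groupIncl, coe_groupIncl, coe_fixedFunIncl,
      key, mul_assoc, Algebra.TensorProduct.tmul_mul_tmul, ← map_mul, mul_inv_cancel, map_one,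
      mul_one, ← Algebra.TensorProduct.one_def, mul_one]
    rfl
  change ofFun k _ L _ ∈ (splitAction α hα).fixed
  rw [h1]
  exact Subtype.property _

lemma exists_trace_ofFun_eq (f : Z2Group Gal(L/k) → L) :
    ∃ f', (splitAction α hα).trace (ofFun k _ L f) = fixedFunIncl α hα f' := by
  have h : ((splitAction α hα).trace (ofFun k _ L f) : L ⊗[k] SplitHopf α hα) =
      ofFun k _ L (∑ g : Gal(L/k), fun s => g (f ((rightMul g).symm s))) := by
    rw [GaloisHopfAction.coe_trace, map_sum]
    exact Finset.sum_congr rfl fun g _ => splitAction_act_ofFun g _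
  have hmem : ofFun k _ L (∑ g : Gal(L/k), fun s => g (f ((rightMul g).symm s))) ∈
      (splitAction α hα).fixed := h ▸ Subtype.property _
  exact ⟨⟨_, hmem⟩, Subtype.ext h⟩

/-- Since `l ⊗ e_t ⊗ n` is the function `l e_t` times the invariant element `1 ⊗ n`, the trace acts
on the function alone. -/
lemma exists_trace_tmul_basis_eq (l : L) (p : Z2Group Gal(L/k) × Ghat α hα) :
    ∃ f, (splitAction α hα).trace (l ⊗ₜ basis k _ p) =
      fixedFunIncl α hα f * groupIncl α hα p.2 := by
  classical
  obtain ⟨f, hf⟩ := exists_trace_ofFun_eq (hα := hα) (Pi.single p.1 l)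
  refine ⟨f, ?_⟩
  rw [← hf, ← GaloisHopfAction.trace_mul_coe, ofFun_single, coe_groupIncl,
    Algebra.TensorProduct.tmul_mul_tmul, basis_mul_ofGroup, mul_one, one_mul]

lemma trace_mem_closure (y : L ⊗[k] SplitHopf α hα) :
    (splitAction α hα).trace y ∈ AddSubgroup.closure
      {x | ∃ f n, x = fixedFunIncl α hα f * groupIncl α hα n} := by
  induction y using induction_tmul_basis with
  | zero => exact (LinearMap.map_zero (splitAction α hα).trace).symm ▸ AddSubgroup.zero_mem _
  | add y z hy hz =>
    exact (LinearMap.map_add (splitAction α hα).trace y z).symm ▸ AddSubgroup.add_mem _ hy hz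
  | tmul l p =>
    obtain ⟨f, hf⟩ := exists_trace_tmul_basis_eq (hα := hα) l p
    exact AddSubgroup.subset_closure ⟨f, p.2, hf⟩

theorem isSemisimpleRing_fixed [IsGalois k L] [Finite (Ghat α hα)]
    (hG : ¬ ringChar k ∣ Nat.card Gal(L/k)) : IsSemisimpleRing (splitAction α hα).fixed := by
  have := isSemisimpleRing_fixedFun (α := α) (hα := hα)
  refine isSemisimpleRing_of_normalized (fixedFunIncl α hα).toRingHom (groupIncl α hα).toHomUnits
    ?_ exists_groupIncl_mul_fixedFunIncl ?_
  · rw [← map_natCast (algebraMap k (splitAction α hα).fixed)]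
    exact (natCast_card_Ghat_ne_zero hG).isUnit.map _
  · refine (AddSubgroup.eq_top_iff' _).2 fun x => ?_
    -- Every invariant `x` is the trace of `a x` when `a` has trace `1`, so generation need only be
    -- known for traces.
    obtain ⟨a, ha⟩ := Algebra.trace_surjective k L 1
    have hx := (splitAction α hα).trace_smul_coe a x
    rw [ha, one_smul] at hx
    exact hx ▸ trace_mem_closure (a • (x : L ⊗[k] SplitHopf α hα))

end Main

end HopfSchur

end

theorem mainTheorem3 {k : Type u} {L : Type v} [Field k] [Field L] [Algebra k L]
    [FiniteDimensional k L] [IsGalois k L]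
    (α : Gal(L/k) × Gal(L/k) → Lˣ) (hα : groupCohomology.IsMulCocycle₂ α)
    (hfin : ∀ g h : Gal(L/k), IsOfFinOrder (α (g, h))) :
    ∃ (H : Type (max u v)) (_ : Ring H) (_ : HopfAlgebra k H),
      FiniteDimensional k H ∧
      Nonempty ((L ⊗[k] H) ≃ₐc[L] (L ⊗[k] HopfSchur.SplitHopf α hα)) ∧
      (∃ f : H →ₐ[k] HopfSchur.CrossedProduct α hα, Function.Surjective f) ∧
      (¬ ringChar k ∣ Nat.card Gal(L/k) → IsSemisimpleRing H) := by
  -- Root-of-unity values make `Ĝ` finite, which gives finite dimension and permits averaging over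
  -- `Ĝ`.
  have := HopfSchur.CrossedProduct.finite_Ghat (hα := hα) hfin
  have : Module.Finite k (HopfSchur.SplitHopf α hα) :=
    Module.Finite.of_basis (HopfSchur.SemidirectHopf.basis k _)
  exact ⟨(HopfSchur.splitAction α hα).fixed, inferInstance,
    (HopfSchur.splitAction α hα).hopfForm.toHopfAlgebra,
    FiniteDimensional.finiteDimensional_submodule
      (Subalgebra.toSubmodule (HopfSchur.splitAction α hα).fixed),
    ⟨(HopfSchur.splitAction α hα).hopfForm.baseChangeEquiv⟩,
    ⟨HopfSchur.evalHom α hα, HopfSchur.evalHom_surjective⟩,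
    HopfSchur.isSemisimpleRing_fixed⟩
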